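/- Let $f:\mathbb{C}\to\mathbb{C}$ be a transcendental entire function (that is, $f$ is entire and not a polynomial), and for $r>0$ put $M(r)=\max_{|z|=r}|f(z)|$ and $m(r)=\min_{|z|=r}|f(z)|$. There exists $r(f)>0$, depending only on $f$, such that, if $r>0$ satisfies $$\log M(r)\le r^{\alpha}\quad\text{and}\quad r^{1-2\alpha}\ge r(f)$$ for some $\alpha\in(0,1/2)$, then there exists $t\in(r^{1-2\alpha},r)$ such that $$\log m(t)>\log M(r^{1-2\alpha})-2,$$ where $\log 0=-\infty$ (so in particular $m(t)>0$). -/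

import Mathlib

/-- A transcendental entire function: holomorphic on all of `ℂ` and not a polynomial. -/
def IsTranscendentalEntire (f : ℂ → ℂ) : Prop :=
  Differentiable ℂ f ∧ ¬ ∃ p : Polynomial ℂ, ∀ z : ℂ, f z = p.eval z

/-- The maximum modulus `M(r) = max_{|z| = r} |f(z)|` (meaningful for `0 ≤ r` and `f` continuous,
when the supremum is attained). -/
noncomputable def maxModulus (f : ℂ → ℂ) (r : ℝ) : ℝ :=
  sSup ((fun z : ℂ => ‖f z‖) '' Metric.sphere (0 : ℂ) r)

/-- The minimum modulus `m(r) = min_{|z| = r} |f(z)|` (meaningful for `0 ≤ r` and `f` continuous,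
when the infimum is attained). -/
noncomputable def minModulus (f : ℂ → ℂ) (r : ℝ) : ℝ :=
  sInf ((fun z : ℂ => ‖f z‖) '' Metric.sphere (0 : ℂ) r)

/-! Write `s = r ^ (1 - 2 * α)`, `y = r ^ α`, so that `r = s * y ^ 2`. If the conclusion fails, then
`g = f / (M(s) * e⁻²)` has modulus at most 1 somewhere on every circle of radius in `(s, r)`, while
`log |g| < y` on `|z| = r`. By Beurling's projection theorem such a `g` is largest when its small
values lie on the negative axis; harmonic measure of a slit disc then bounds `log |g|` just outside
`|z| = s` by about `y * (4 / π) * √(2 * s / r)`, a constant below 2. Hence `M` takes a value below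
`M(s)` at a radius beyond `s`, against the maximum principle.

The projection (`exists_radial_comparison_of_zeros`) moves each Blaschke zero to the negative axis
and treats the zero-free factor by Harnack. The harmonic measure bound is
`norm_le_exp_of_norm_le_one_on_slit`. Polynomial approximation carries the estimate to entire
functions. -/

/-! ### Zero-free functions and Harnack's inequality -/

open Metric Set in
/-- A zero-free holomorphic function on a disc has, up to a multiplicative constant, a holomorphic
logarithm. -/
theorem exists_eq_mul_exp_of_ne_zero_on_ball {k : ℂ → ℂ} {r : ℝ}
    (hk : DifferentiableOn ℂ k (ball 0 r)) (h0 : ∀ z ∈ ball (0 : ℂ) r, k z ≠ 0) :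
    ∃ G : ℂ → ℂ, DifferentiableOn ℂ G (ball 0 r) ∧ G 0 = 0 ∧
      ∀ z ∈ ball (0 : ℂ) r, k z = k 0 * Complex.exp (G z) := by
  have hd : DifferentiableOn ℂ (fun z => deriv k z / k z) (ball 0 r) :=
    (hk.deriv isOpen_ball).div hk h0
  obtain ⟨F, hF⟩ := hd.isExactOn_ball
  refine ⟨fun z => F z - F 0,
    fun z hz => ((hF z hz).sub_const (F 0)).differentiableAt.differentiableWithinAt, by simp, ?_⟩
  intro z hz
  have hr : 0 < r := pos_of_mem_ball hz
  have hc : ∀ w ∈ ball (0 : ℂ) r, HasDerivAt (fun z => k z * Complex.exp (-(F z - F 0))) 0 w := by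
    intro w hw
    have h1 := (hk.differentiableAt (isOpen_ball.mem_nhds hw)).hasDerivAt
    refine (h1.mul (((hF w hw).sub_const (F 0)).neg.cexp)).congr_deriv ?_
    have := h0 w hw
    simp only [Pi.neg_apply]
    field_simp
    ring
  have hz' := (convex_ball (0 : ℂ) r).is_const_of_fderivWithin_eq_zero (𝕜 := ℂ)
    (f := fun z => k z * Complex.exp (-(F z - F 0)))
    (fun w hw => (hc w hw).differentiableAt.differentiableWithinAt)
    (fun w hw => by
      rw [fderivWithin_of_isOpen isOpen_ball hw]
      ext
      simpa using (hc w hw).deriv) hz (mem_ball_self hr)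
  simp only [sub_self, neg_zero, Complex.exp_zero, mul_one] at hz'
  rw [← hz', mul_assoc, ← Complex.exp_add]
  simp

open Metric Set in
/-- Harnack's inequality for the positive harmonic function `log (K / |k|)`. -/
theorem harnack_of_ne_zero_of_norm_lt {k : ℂ → ℂ} {r K : ℝ} (hr : 0 < r)
    (hk : DifferentiableOn ℂ k (ball 0 r)) (h0 : ∀ z ∈ ball (0 : ℂ) r, k z ≠ 0)
    (hK : ∀ z ∈ ball (0 : ℂ) r, ‖k z‖ < K) :
    ∃ c : ℝ, 0 < c ∧ ∀ z ∈ ball (0 : ℂ) r,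
      K * Real.exp (-(c * ((r + ‖z‖) / (r - ‖z‖)))) ≤ ‖k z‖ ∧
      ‖k z‖ ≤ K * Real.exp (-(c * ((r - ‖z‖) / (r + ‖z‖)))) := by
  obtain ⟨G, hG, hG0, hkG⟩ := exists_eq_mul_exp_of_ne_zero_on_ball hk h0
  have m0 : (0 : ℂ) ∈ ball (0 : ℂ) r := mem_ball_self hr
  have hk0 : 0 < ‖k 0‖ := norm_pos_iff.2 (h0 0 m0)
  have hKpos : 0 < K := hk0.trans (hK 0 m0)
  set c := Real.log (K / ‖k 0‖) with hc
  have hcpos : 0 < c := Real.log_pos ((one_lt_div hk0).2 (hK 0 m0))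
  have hec : Real.exp (-c) = ‖k 0‖ / K := by
    rw [Real.exp_neg, hc, Real.exp_log (by positivity), inv_div]
  set q : ℂ → ℂ := fun z => c - G z with hq
  have hnorm : ∀ z ∈ ball (0 : ℂ) r, ‖k z‖ = K * Real.exp (-(q z).re) := by
    intro z hz
    rw [hkG z hz, norm_mul, Complex.norm_exp]
    have : -(q z).re = -c + (G z).re := by simp [hq]; ring
    rw [this, Real.exp_add, hec]
    field_simp
  have hqre : ∀ z ∈ ball (0 : ℂ) r, 0 < (q z).re := by
    intro z hz
    have h := hK z hz
    rw [hnorm z hz] at h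
    have : Real.exp (-(q z).re) < 1 := by
      by_contra hcon
      push Not at hcon
      nlinarith
    rw [Real.exp_lt_one_iff] at this
    linarith
  have hne : ∀ z ∈ ball (0 : ℂ) r, q z + c ≠ 0 := by
    intro z hz h
    have := congrArg Complex.re h
    simp at this
    linarith [hqre z hz]
  -- Schwarz's lemma for the Cayley transform of `q`, which maps into the right half-plane with `q 0
  -- = c`.
  have hsch : ∀ z ∈ ball (0 : ℂ) r, ‖(q z - c) / (q z + c)‖ ≤ ‖z‖ / r := by
    intro z hz
    have hqd : DifferentiableOn ℂ q (ball 0 r) := (differentiableOn_const _).sub hG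
    have hd : DifferentiableOn ℂ (fun z => (q z - c) / (q z + c)) (ball 0 r) :=
      (hqd.sub_const _).div (hqd.add_const _) hne
    have hw0 : (q 0 - c) / (q 0 + c) = 0 := by simp [hq, hG0]
    have := Complex.dist_le_div_mul_dist_of_mapsTo_ball (R₂ := 1) hd (fun w hw => by
      rw [hw0, mem_closedBall_zero_iff, norm_div]
      refine div_le_one_of_le₀ ?_ (norm_nonneg _)
      rw [← sq_le_sq₀ (norm_nonneg _) (norm_nonneg _), Complex.sq_norm, Complex.sq_norm,
        Complex.normSq_apply, Complex.normSq_apply]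
      simp
      nlinarith [hqre w hw]) hz
    rw [hw0] at this
    simpa [div_eq_inv_mul] using this
  refine ⟨c, hcpos, fun z hz => ?_⟩
  have hzr : ‖z‖ < r := mem_ball_zero_iff.1 hz
  have hz0 := norm_nonneg z
  have hA := hqre z hz
  have h1 : ‖q z - c‖ ≤ ‖z‖ / r * ‖q z + c‖ := by
    have := hsch z hz
    rwa [norm_div, div_le_iff₀ (norm_pos_iff.2 (hne z hz))] at this
  have h2 : r * ‖q z - c‖ ≤ ‖z‖ * ‖q z + c‖ := by
    calc r * ‖q z - c‖ ≤ r * (‖z‖ / r * ‖q z + c‖) := by gcongr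
      _ = _ := by field_simp
  have h3 : (r * ‖q z - c‖) ^ 2 ≤ (‖z‖ * ‖q z + c‖) ^ 2 := by gcongr
  rw [mul_pow, mul_pow, Complex.sq_norm (q z - c), Complex.sq_norm (q z + c),
    Complex.normSq_apply, Complex.normSq_apply] at h3
  simp only [Complex.sub_re, Complex.ofReal_re, Complex.sub_im, Complex.ofReal_im, sub_zero,
    Complex.add_re, Complex.add_im, add_zero] at h3
  have h4 : |r * ((q z).re - c)| ≤ ‖z‖ * ((q z).re + c) := by
    refine abs_le_of_sq_le_sq ?_ (by positivity)
    have : ‖z‖ ^ 2 * ((q z).im * (q z).im) ≤ r ^ 2 * ((q z).im * (q z).im) := by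
      have := mul_self_nonneg (q z).im
      gcongr
    nlinarith
  rw [abs_le] at h4
  rw [hnorm z hz]
  constructor
  · gcongr
    rw [← mul_div_assoc, le_div_iff₀ (by linarith)]
    nlinarith
  · gcongr
    rw [← mul_div_assoc, div_le_iff₀ (by linarith)]
    nlinarith

/-! ### Blaschke factors and projection of zeros -/

/-- The identity behind the comparison of Blaschke factors. -/
theorem norm_sq_blaschke_denom_sub (a z : ℂ) (r : ℝ) :
    ‖(r : ℂ) ^ 2 - starRingEnd ℂ a * z‖ ^ 2 - r ^ 2 * ‖z - a‖ ^ 2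
      = (r ^ 2 - ‖z‖ ^ 2) * (r ^ 2 - ‖a‖ ^ 2) := by
  simp only [Complex.sq_norm, Complex.normSq_apply]
  simp [pow_two]
  ring

/-- For fixed `‖a‖` and `‖z‖` the squared Blaschke factor is `u / (u + P)` with `u = r ^ 2 * ‖z - a‖
^ 2` and `P` constant, hence increasing in `‖z - a‖`. The extremes occur for `a` opposite to `z`
(here) and aligned with `z` (`le_norm_blaschke`). -/
theorem norm_blaschke_le {a z : ℂ} {r : ℝ} (ha : ‖a‖ < r) (hz : ‖z‖ < r) :
    r * ‖z - a‖ * (r ^ 2 + ‖a‖ * ‖z‖)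
      ≤ r * (‖z‖ + ‖a‖) * ‖(r : ℂ) ^ 2 - starRingEnd ℂ a * z‖ := by
  have h := norm_sq_blaschke_denom_sub a z r
  have ha0 := norm_nonneg a
  have hz0 := norm_nonneg z
  have hr : 0 < r := ha0.trans_lt ha
  have h1 : ‖z - a‖ ≤ ‖z‖ + ‖a‖ := norm_sub_le _ _
  have h1' : ‖z - a‖ ^ 2 ≤ (‖z‖ + ‖a‖) ^ 2 := by gcongr
  refine le_of_sq_le_sq ?_ (by positivity)
  have hP : 0 ≤ (r ^ 2 - ‖z‖ ^ 2) * (r ^ 2 - ‖a‖ ^ 2) :=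
    mul_nonneg (by nlinarith) (by nlinarith)
  have e : ‖(r : ℂ) ^ 2 - starRingEnd ℂ a * z‖ ^ 2
      = r ^ 2 * ‖z - a‖ ^ 2 + (r ^ 2 - ‖z‖ ^ 2) * (r ^ 2 - ‖a‖ ^ 2) := by linarith
  rw [mul_pow, mul_pow, mul_pow, mul_pow, e]
  have key := mul_le_mul_of_nonneg_left h1' (mul_nonneg (sq_nonneg r) hP)
  nlinarith

theorem le_norm_blaschke {a z : ℂ} {r : ℝ} (ha : ‖a‖ < r) (hz : ‖z‖ < r) :
    r * |‖z‖ - ‖a‖| * ‖(r : ℂ) ^ 2 - starRingEnd ℂ a * z‖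
      ≤ r * ‖z - a‖ * (r ^ 2 - ‖a‖ * ‖z‖) := by
  have h := norm_sq_blaschke_denom_sub a z r
  have ha0 := norm_nonneg a
  have hz0 := norm_nonneg z
  have hr : 0 < r := ha0.trans_lt ha
  have h1 : |‖z‖ - ‖a‖| ≤ ‖z - a‖ := abs_norm_sub_norm_le _ _
  have h1' : |‖z‖ - ‖a‖| ^ 2 ≤ ‖z - a‖ ^ 2 := by gcongr
  have haz : ‖a‖ * ‖z‖ ≤ r ^ 2 := by nlinarith
  refine le_of_sq_le_sq ?_ (mul_nonneg (by positivity) (by linarith))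
  have hP : 0 ≤ (r ^ 2 - ‖z‖ ^ 2) * (r ^ 2 - ‖a‖ ^ 2) :=
    mul_nonneg (by nlinarith) (by nlinarith)
  have e : ‖(r : ℂ) ^ 2 - starRingEnd ℂ a * z‖ ^ 2
      = r ^ 2 * ‖z - a‖ ^ 2 + (r ^ 2 - ‖z‖ ^ 2) * (r ^ 2 - ‖a‖ ^ 2) := by linarith
  rw [mul_pow, mul_pow, mul_pow, mul_pow, e]
  have key := mul_le_mul_of_nonneg_left h1' (mul_nonneg (sq_nonneg r) hP)
  rw [sq_abs] at key ⊢
  nlinarith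

open Metric Set in
/-- Beurling's projection of the zeros to the negative real axis: a holomorphic function with zeros
`S` is compared with a function on the disc which is smaller on the negative radius and larger on
the positive one. -/
theorem exists_radial_comparison_of_zeros {r C K : ℝ} (hr : 0 < r) (hCK : C < K)
    (S : Multiset ℂ) (hS : ∀ a ∈ S, ‖a‖ < r) (k : ℂ → ℂ) (hk : Differentiable ℂ k)
    (hk0 : ∀ z ∈ ball (0 : ℂ) r, k z ≠ 0)
    (hC : ∀ z : ℂ, ‖z‖ = r → ‖(S.map (fun a => z - a)).prod * k z‖ ≤ C) :
    ∃ F : ℂ → ℂ, DifferentiableOn ℂ F (ball 0 r) ∧ (∀ z ∈ ball (0 : ℂ) r, ‖F z‖ ≤ K) ∧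
      ∀ z ∈ ball (0 : ℂ) r, ‖F (-(‖z‖ : ℂ))‖ ≤ ‖(S.map (fun a => z - a)).prod * k z‖ ∧
        ‖(S.map (fun a => z - a)).prod * k z‖ ≤ ‖F (‖z‖ : ℂ)‖ := by
  induction S using Multiset.induction_on generalizing k with
  | empty =>
    simp only [Multiset.map_zero, Multiset.prod_zero, one_mul] at hC ⊢
    have hkK : ∀ z ∈ ball (0 : ℂ) r, ‖k z‖ < K := by
      intro z hz
      refine lt_of_le_of_lt ?_ hCK
      refine Complex.norm_le_of_forall_mem_frontier_norm_le isBounded_ball hk.diffContOnCl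
        (fun w hw => hC w ?_) (subset_closure hz)
      rw [frontier_ball _ hr.ne'] at hw
      exact mem_sphere_zero_iff_norm.1 hw
    obtain ⟨c, hc, hH⟩ := harnack_of_ne_zero_of_norm_lt hr hk.differentiableOn hk0 hkK
    have hKpos : 0 < K := (norm_nonneg _).trans_lt (hkK 0 (mem_ball_self hr))
    have hne : ∀ z ∈ ball (0 : ℂ) r, (r : ℂ) + z ≠ 0 := by
      intro z hz h
      have : z = -(r : ℂ) := by linear_combination h
      rw [mem_ball_zero_iff, this, norm_neg, Complex.norm_real, Real.norm_of_nonneg hr.le] at hz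
      exact lt_irrefl _ hz
    have hnorm : ∀ t : ℝ, ‖(K : ℂ) * Complex.exp (-(c * ((r - (t : ℂ)) / (r + (t : ℂ)))))‖
        = K * Real.exp (-(c * ((r - t) / (r + t)))) := by
      intro t
      rw [norm_mul, Complex.norm_real, Real.norm_of_nonneg hKpos.le, Complex.norm_exp]
      congr 2
      have : (-(c * ((r - (t : ℂ)) / (r + (t : ℂ)))) : ℂ)
        = ((-(c * ((r - t) / (r + t))) : ℝ) : ℂ) := by push_cast; rfl
      rw [this, Complex.ofReal_re]
    -- This function attains the two Harnack bounds at `-‖z‖` and `‖z‖`.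
    refine ⟨fun z => K * Complex.exp (-(c * ((r - z) / (r + z)))), ?_, ?_, ?_⟩
    · refine DifferentiableOn.const_mul (DifferentiableOn.cexp (DifferentiableOn.neg
        (DifferentiableOn.const_mul (DifferentiableOn.div ?_ ?_ hne) _))) _ <;> fun_prop
    · intro z hz
      rw [norm_mul, Complex.norm_real, Real.norm_of_nonneg hKpos.le, Complex.norm_exp]
      refine mul_le_of_le_one_right hKpos.le (Real.exp_le_one_iff.2 ?_)
      rw [Complex.neg_re, Complex.re_ofReal_mul, neg_nonpos]
      refine mul_nonneg hc.le ?_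
      rw [Complex.div_re, ← add_div]
      refine div_nonneg ?_ (Complex.normSq_nonneg _)
      have : ‖z‖ ^ 2 < r ^ 2 := by
        have := mem_ball_zero_iff.1 hz
        gcongr
      rw [Complex.sq_norm, Complex.normSq_apply] at this
      simp
      nlinarith
    · intro z hz
      obtain ⟨h1, h2⟩ := hH z hz
      refine ⟨?_, ?_⟩
      · have := hnorm (-‖z‖)
        push_cast at this
        rw [this]
        simpa [sub_neg_eq_add, ← sub_eq_add_neg] using h1
      · rw [hnorm ‖z‖]
        exact h2
  | cons a S ih =>
    have ha : ‖a‖ < r := hS a (by simp)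
    have ha0 := norm_nonneg a
    have hdne : ∀ b z : ℂ, ‖b‖ < r → ‖z‖ < r → (r : ℂ) ^ 2 - starRingEnd ℂ b * z ≠ 0 := by
      intro b z hb hz h
      have h1 : (r : ℂ) ^ 2 = starRingEnd ℂ b * z := by linear_combination h
      have h2 := congrArg norm h1
      rw [norm_pow, norm_mul, RCLike.norm_conj, Complex.norm_real, Real.norm_of_nonneg hr.le] at h2
      nlinarith [norm_nonneg b, norm_nonneg z]
    have hkd : Differentiable ℂ fun z => ((r : ℂ) ^ 2 - starRingEnd ℂ a * z) / r * k z := by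
      fun_prop
    have hrC : (r : ℂ) ≠ 0 := by exact_mod_cast hr.ne'
    -- The factor `z - a` is traded for one without zeros in the disc and of equal modulus on `|z| =
    -- r`, so the boundary bound survives.
    obtain ⟨F, hF, hFK, hFz⟩ := ih (fun b hb => hS b (Multiset.mem_cons_of_mem hb))
      (fun z => ((r : ℂ) ^ 2 - starRingEnd ℂ a * z) / r * k z) hkd
      (fun z hz => mul_ne_zero (div_ne_zero (hdne a z ha (mem_ball_zero_iff.1 hz)) hrC) (hk0 z hz))
      (by
        intro z hz
        have h1 := norm_sq_blaschke_denom_sub a z r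
        rw [hz, sub_self, zero_mul, sub_eq_zero, ← mul_pow] at h1
        have h2 : ‖(r : ℂ) ^ 2 - starRingEnd ℂ a * z‖ = r * ‖z - a‖ :=
          (pow_left_inj₀ (norm_nonneg _) (by positivity) two_ne_zero).1 h1
        refine le_trans (le_of_eq ?_) (hC z hz)
        rw [Multiset.map_cons, Multiset.prod_cons]
        simp only [norm_mul, norm_div, h2, Complex.norm_real, Real.norm_of_nonneg hr.le]
        field_simp)
    have hane : ∀ z ∈ ball (0 : ℂ) r, (r : ℂ) ^ 2 + ‖a‖ * z ≠ 0 := by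
      intro z hz
      have := hdne (-(‖a‖ : ℂ)) z (by simpa using ha) (mem_ball_zero_iff.1 hz)
      simpa [sub_neg_eq_add] using this
    have hbound : ∀ z ∈ ball (0 : ℂ) r, ‖r * (z + ‖a‖) / ((r : ℂ) ^ 2 + ‖a‖ * z)‖ ≤ 1 := by
      intro z hz
      have hz' := mem_ball_zero_iff.1 hz
      rw [norm_div]
      refine div_le_one_of_le₀ ?_ (norm_nonneg _)
      have h := norm_sq_blaschke_denom_sub (-(‖a‖ : ℂ)) z r
      have e : (r : ℂ) ^ 2 - starRingEnd ℂ (-(‖a‖ : ℂ)) * z = (r : ℂ) ^ 2 + ‖a‖ * z := by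
        simp [sub_neg_eq_add]
      rw [e, sub_neg_eq_add, norm_neg, Complex.norm_real, norm_norm] at h
      rw [norm_mul, Complex.norm_real, Real.norm_of_nonneg hr.le]
      refine le_of_sq_le_sq ?_ (norm_nonneg _)
      have hP : 0 ≤ (r ^ 2 - ‖z‖ ^ 2) * (r ^ 2 - ‖a‖ ^ 2) :=
        mul_nonneg (by nlinarith [norm_nonneg z]) (by nlinarith)
      rw [mul_pow]
      linarith
    refine ⟨fun z => r * (z + ‖a‖) / ((r : ℂ) ^ 2 + ‖a‖ * z) * F z, ?_, ?_, ?_⟩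
    · refine DifferentiableOn.mul (DifferentiableOn.div ?_ ?_ hane) hF <;> fun_prop
    · intro z hz
      rw [norm_mul]
      exact (mul_le_of_le_one_left (norm_nonneg _) (hbound z hz)).trans (hFK z hz)
    · intro z hz
      have hzr := mem_ball_zero_iff.1 hz
      have hz0 := norm_nonneg z
      obtain ⟨h1, h2⟩ := hFz z hz
      have hD : 0 < ‖(r : ℂ) ^ 2 - starRingEnd ℂ a * z‖ := norm_pos_iff.2 (hdne a z ha hzr)
      have hsplit : ‖((a ::ₘ S).map (fun a => z - a)).prod * k z‖
          = r * ‖z - a‖ / ‖(r : ℂ) ^ 2 - starRingEnd ℂ a * z‖ *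
            ‖(S.map (fun a => z - a)).prod *
              (((r : ℂ) ^ 2 - starRingEnd ℂ a * z) / r * k z)‖ := by
        rw [Multiset.map_cons, Multiset.prod_cons]
        simp only [norm_mul, norm_div, Complex.norm_real, Real.norm_of_nonneg hr.le]
        have hD' := hD.ne'
        generalize ‖(r : ℂ) ^ 2 - starRingEnd ℂ a * z‖ = D at hD' ⊢
        field_simp
      have hfac : ∀ t : ℝ, 0 < r ^ 2 + ‖a‖ * t →
          ‖r * ((t : ℂ) + ‖a‖) / ((r : ℂ) ^ 2 + ‖a‖ * (t : ℂ))‖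
            = r * |t + ‖a‖| / (r ^ 2 + ‖a‖ * t) := by
        intro t ht
        have : (r * ((t : ℂ) + ‖a‖) / ((r : ℂ) ^ 2 + ‖a‖ * (t : ℂ)))
          = ((r * (t + ‖a‖) / (r ^ 2 + ‖a‖ * t) : ℝ) : ℂ) := by push_cast; rfl
        rw [this, Complex.norm_real, Real.norm_eq_abs, abs_div, abs_mul, abs_of_pos hr,
          abs_of_pos ht]
      have hlt : ‖a‖ * ‖z‖ < r ^ 2 := by nlinarith
      rw [hsplit, norm_mul, norm_mul (_ / _) (F _)]
      constructor
      · have e := hfac (-‖z‖) (by nlinarith)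
        push_cast at e
        rw [e]
        refine mul_le_mul ?_ h1 (norm_nonneg _) (by positivity)
        rw [div_le_div_iff₀ (by nlinarith) hD]
        have := le_norm_blaschke ha hzr
        rw [abs_sub_comm] at this
        rwa [neg_add_eq_sub, mul_neg, ← sub_eq_add_neg]
      · rw [hfac ‖z‖ (by positivity)]
        refine mul_le_mul ?_ h2 (norm_nonneg _) (by positivity)
        rw [div_le_div_iff₀ hD (by positivity), abs_of_nonneg (by positivity)]
        exact norm_blaschke_le ha hzr

open Metric Set Polynomial in
theorem Polynomial.exists_radial_comparison {r C K : ℝ} (hr : 0 < r) (hCK : C < K)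
    (p : ℂ[X]) (hp : p ≠ 0) (hC : ∀ z : ℂ, ‖z‖ = r → ‖p.eval z‖ ≤ C) :
    ∃ F : ℂ → ℂ, DifferentiableOn ℂ F (ball 0 r) ∧ (∀ z ∈ ball (0 : ℂ) r, ‖F z‖ ≤ K) ∧
      ∀ z ∈ ball (0 : ℂ) r, ‖F (-(‖z‖ : ℂ))‖ ≤ ‖p.eval z‖ ∧ ‖p.eval z‖ ≤ ‖F (‖z‖ : ℂ)‖ := by
  classical
  set q : ℂ[X] := Polynomial.C p.leadingCoeff *
    ((p.roots.filter (fun a => ¬ ‖a‖ < r)).map (fun a => X - Polynomial.C a)).prod with hq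
  have hpq : ∀ z, p.eval z =
      ((p.roots.filter (fun a => ‖a‖ < r)).map (fun a => z - a)).prod * q.eval z := by
    intro z
    conv_lhs => rw [(IsAlgClosed.splits p).eq_prod_roots]
    conv_lhs => rw [← Multiset.filter_add_not (fun a => ‖a‖ < r) p.roots]
    simp only [hq, eval_mul, eval_C, eval_multiset_prod, Multiset.map_map, Multiset.map_add,
      Multiset.prod_add, Function.comp_def, eval_sub, eval_X]
    ring
  have := exists_radial_comparison_of_zeros hr hCK (p.roots.filter (fun a => ‖a‖ < r))
    (fun a ha => (Multiset.mem_filter.1 ha).2) (fun z => q.eval z) q.differentiable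
    (by
      intro z hz h
      simp only [hq, eval_mul, eval_C, eval_multiset_prod, Multiset.map_map, Function.comp_def,
        eval_sub, eval_X] at h
      rcases mul_eq_zero.1 h with h | h
      · exact hp (leadingCoeff_eq_zero.1 h)
      · rw [Multiset.prod_eq_zero_iff, Multiset.mem_map] at h
        obtain ⟨a, ha, h⟩ := h
        rw [Multiset.mem_filter] at ha
        rw [sub_eq_zero.1 h] at hz
        exact ha.2 (mem_ball_zero_iff.1 hz))
    (fun z hz => by rw [← hpq]; exact hC z hz)
  simpa only [← hpq] using this

/-! ### Harmonic measure in a slit disc -/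

theorem Complex.exp_add_one_ne_zero_and_norm_le {z : ℂ} (h0 : 0 ≤ z.im) (h1 : z.im ≤ Real.pi / 2) :
    Complex.exp z + 1 ≠ 0 ∧ ‖(Complex.exp z - 1) / (Complex.exp z + 1)‖ ≤ 1 := by
  have hre : 0 ≤ (Complex.exp z).re := by
    rw [Complex.exp_re]
    exact mul_nonneg (Real.exp_pos _).le (Real.cos_nonneg_of_neg_pi_div_two_le_of_le
      (by linarith [Real.pi_pos]) h1)
  constructor
  · intro h
    have := congrArg Complex.re h
    simp only [Complex.add_re, Complex.one_re, Complex.zero_re] at this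
    linarith
  · rw [norm_div]
    refine div_le_one_of_le₀ (le_of_sq_le_sq ?_ (norm_nonneg _)) (norm_nonneg _)
    rw [Complex.sq_norm, Complex.sq_norm, Complex.normSq_apply, Complex.normSq_apply]
    simp only [Complex.sub_re, Complex.one_re, Complex.sub_im, Complex.one_im, Complex.add_re,
      Complex.add_im]
    nlinarith

open Metric Set Complex in
/-- Two-constants estimate in a disc slit along a segment of the negative axis. The slit disc of
radius `ρ²` about `-s` is parametrised by the strip `0 ≤ Im ≤ π / 2`. -/
theorem norm_le_exp_of_norm_le_one_on_slit {F : ℂ → ℂ} {r s ρ L : ℝ} (hs : 0 < s) (hρ : 0 < ρ)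
    (hsr : s + ρ ^ 2 < r) (hsρ : 2 * s ≤ ρ ^ 2) (hL : 0 ≤ L)
    (hF : DifferentiableOn ℂ F (ball 0 r)) (hFL : ∀ z ∈ ball (0 : ℂ) r, ‖F z‖ ≤ Real.exp L)
    (hslit : ∀ t ∈ Icc s (s + ρ ^ 2), ‖F (-(t : ℂ))‖ ≤ 1) :
    ‖F s‖ ≤ Real.exp (L * (4 / Real.pi * (Real.sqrt (2 * s) / ρ))) := by
  have hpi := Real.pi_pos
  -- `exp` sends the strip to a quadrant, the Cayley map sends that to a half-disc, and squaring
  -- opens it to the slit disc: the real line goes to the slit, the upper edge to the circle.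
  set T : ℂ → ℂ := fun z => (exp z - 1) / (exp z + 1) with hT
  set h : ℂ → ℂ := fun z => -(s + ρ ^ 2 * T z ^ 2) with hh
  have hball : ∀ z : ℂ, 0 ≤ z.im → z.im ≤ Real.pi / 2 → h z ∈ ball (0 : ℂ) r := by
    intro z h0 h1
    have hT1 : ‖T z‖ ≤ 1 := (Complex.exp_add_one_ne_zero_and_norm_le h0 h1).2
    rw [mem_ball_zero_iff, hh, norm_neg]
    calc ‖(s : ℂ) + ρ ^ 2 * T z ^ 2‖ ≤ ‖(s : ℂ)‖ + ‖(ρ : ℂ) ^ 2 * T z ^ 2‖ := norm_add_le _ _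
      _ = s + ρ ^ 2 * ‖T z‖ ^ 2 := by
        rw [norm_mul, norm_pow, norm_pow, norm_real, norm_real, Real.norm_of_nonneg hs.le,
          Real.norm_of_nonneg hρ.le]
      _ ≤ s + ρ ^ 2 * 1 ^ 2 := by gcongr
      _ < r := by linarith
  -- The extra factor has modulus 1 on the real line and `e⁻ᴸ` on the upper edge, making `‖Φ‖ ≤ 1`
  -- on both.
  set Φ : ℂ → ℂ := fun z => F (h z) * exp (I * ((2 * L / Real.pi : ℝ) * z)) with hΦ
  have hexp : ∀ z : ℂ, ‖exp (I * ((2 * L / Real.pi : ℝ) * z))‖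
      = Real.exp (-(2 * L / Real.pi * z.im)) := by
    intro z
    rw [Complex.norm_exp, I_mul_re, im_ofReal_mul]
  have hdiff : ∀ z : ℂ, 0 ≤ z.im → z.im ≤ Real.pi / 2 → DifferentiableAt ℂ Φ z := by
    intro z h0 h1
    have hne := (Complex.exp_add_one_ne_zero_and_norm_le h0 h1).1
    have hTd : DifferentiableAt ℂ T z :=
      DifferentiableAt.div (by fun_prop) (by fun_prop) hne
    have hhd : DifferentiableAt ℂ h z := by fun_prop
    have hFd : DifferentiableAt ℂ F (h z) :=
      hF.differentiableAt (isOpen_ball.mem_nhds (hball z h0 h1))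
    exact (hFd.comp z hhd).mul (by fun_prop)
  have hΦL : ∀ z : ℂ, 0 ≤ z.im → z.im ≤ Real.pi / 2 → ‖Φ z‖ ≤ Real.exp L := by
    intro z h0 h1
    rw [hΦ, norm_mul, hexp]
    refine (mul_le_of_le_one_right (norm_nonneg _) (Real.exp_le_one_iff.2 ?_)).trans
      (hFL _ (hball z h0 h1))
    rw [neg_nonpos]
    positivity
  have hPL : ∀ z : ℂ, 0 ≤ z.im → z.im ≤ Real.pi / 2 → ‖Φ z‖ ≤ 1 := by
    intro z h0 h1
    refine PhragmenLindelof.horizontal_strip (a := 0) (b := Real.pi / 2) (f := Φ) ?_ ?_ ?_ ?_ h0 h1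
    · refine DifferentiableOn.diffContOnCl fun w hw => ?_
      have : w ∈ im ⁻¹' Icc 0 (Real.pi / 2) :=
        closure_minimal (preimage_mono Ioo_subset_Icc_self)
          (isClosed_Icc.preimage continuous_im) hw
      exact (hdiff w this.1 this.2).differentiableWithinAt
    · refine ⟨0, div_pos hpi (by linarith), 0, ?_⟩
      simp only [zero_mul, Real.exp_zero]
      refine Asymptotics.IsBigO.of_bound (Real.exp L) ?_
      refine Filter.mem_inf_of_right ?_
      intro w hw
      simpa using hΦL w hw.1.le hw.2.le
    · intro w hw
      rw [hΦ, norm_mul, hexp, hw]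
      simp only [mul_zero, neg_zero, Real.exp_zero, mul_one]
      set τ : ℝ := (Real.exp w.re - 1) / (Real.exp w.re + 1) with hτ
      have hwr : w = (w.re : ℂ) := Complex.ext rfl (by simpa using hw)
      have hTτ : T w = (τ : ℂ) := by
        rw [hT, hτ, hwr]
        push_cast
        rfl
      have hτ1 : τ ^ 2 ≤ 1 := by
        have h2 := (Complex.exp_add_one_ne_zero_and_norm_le hw.ge (by rw [hw]; positivity)).2
        change ‖T w‖ ≤ 1 at h2
        rw [hTτ, norm_real, Real.norm_eq_abs] at h2
        exact (sq_le_one_iff_abs_le_one τ).2 h2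
      have hhw : h w = -((s + ρ ^ 2 * τ ^ 2 : ℝ) : ℂ) := by
        rw [hh]
        simp only [hTτ]
        push_cast
        rfl
      rw [hhw]
      exact hslit _ ⟨by nlinarith [sq_nonneg τ, sq_nonneg ρ, mul_nonneg (sq_nonneg ρ) (sq_nonneg τ)],
        by nlinarith [sq_nonneg ρ]⟩
    · intro w hw
      rw [hΦ, norm_mul, hexp, hw]
      have e : 2 * L / Real.pi * (Real.pi / 2) = L := by field_simp
      rw [e, Real.exp_neg]
      have := hFL _ (hball w (by rw [hw]; positivity) hw.le)
      rwa [← div_eq_mul_inv, div_le_one (Real.exp_pos _)]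
  set x : ℝ := Real.sqrt (2 * s) / ρ with hx
  have hx0 : 0 ≤ x := by positivity
  have hx2 : ρ ^ 2 * x ^ 2 = 2 * s := by
    rw [hx, div_pow, Real.sq_sqrt (by positivity)]
    field_simp
  have hx1 : x ≤ 1 := by
    rw [hx, div_le_one hρ]
    exact Real.sqrt_le_iff.2 ⟨hρ.le, hsρ⟩
  set θ : ℝ := Real.arctan x with hθ
  have hθ0 : 0 ≤ θ := Real.arctan_nonneg.2 hx0
  have hθ1 : θ ≤ Real.pi / 4 := by
    rw [← Real.arctan_one]
    exact Real.arctan_mono hx1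
  have hθx : θ ≤ x := by
    have := Real.le_tan hθ0 (by linarith)
    rwa [hθ, Real.tan_arctan] at this
  -- The preimage of `s` under `h`: `T (2 * i * θ) = i * tan θ` and `tan θ ^ 2 = 2 * s / ρ ^ 2`.
  set ζ : ℂ := ((2 * θ : ℝ) : ℂ) * I with hζ
  have hζim : ζ.im = 2 * θ := by simp [hζ]
  have hTζ : T ζ = x * I := by
    have hcos : Real.cos θ ≠ 0 := (Real.cos_arctan_pos x).ne'
    have hsin : Real.sin θ = x * Real.cos θ := by
      have := Real.tan_arctan x
      rw [← hθ, Real.tan_eq_sin_div_cos, div_eq_iff hcos] at this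
      exact this
    have hne := (Complex.exp_add_one_ne_zero_and_norm_le (z := ζ) (by rw [hζim]; positivity)
      (by rw [hζim]; linarith)).1
    change (exp ζ - 1) / (exp ζ + 1) = x * I
    rw [div_eq_iff hne]
    have hc2 := Real.cos_sq_add_sin_sq θ
    rw [hζ, exp_mul_I, ← ofReal_cos, ← ofReal_sin, Real.cos_two_mul, Real.sin_two_mul]
    rw [hsin] at hc2 ⊢
    generalize Real.cos θ = c at hc2
    have hc3 : (c : ℂ) ^ 2 + ((x : ℂ) * c) ^ 2 = 1 := by exact_mod_cast hc2
    push_cast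
    linear_combination 2 * hc3 - 2 * (x : ℂ) ^ 2 * (c : ℂ) ^ 2 * I_sq
  have hhζ : h ζ = s := by
    have : (ρ : ℂ) ^ 2 * (x : ℂ) ^ 2 = 2 * s := by exact_mod_cast hx2
    simp only [hh, hTζ]
    rw [mul_pow, I_sq]
    linear_combination this
  have hfin := hPL ζ (by rw [hζim]; positivity) (by rw [hζim]; linarith)
  rw [hΦ, norm_mul, hexp, hhζ, hζim, Real.exp_neg, ← div_eq_mul_inv,
    div_le_one (Real.exp_pos _)] at hfin
  refine hfin.trans (Real.exp_le_exp.2 ?_)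
  calc 2 * L / Real.pi * (2 * θ) = L * (4 / Real.pi * θ) := by ring
    _ ≤ L * (4 / Real.pi * x) := by gcongr

/-! ### Beurling's estimate: polynomials, then entire functions -/

open Metric Set Polynomial in
theorem Polynomial.norm_le_exp_of_circles {p : ℂ[X]} {r s ρ C L : ℝ} (hs : 0 < s) (hρ : 0 < ρ)
    (hsr : s + ρ ^ 2 < r) (hsρ : 2 * s ≤ ρ ^ 2) (hL : 0 ≤ L) (hCL : C < Real.exp L)
    (hC : ∀ z : ℂ, ‖z‖ = r → ‖p.eval z‖ ≤ C)
    (hmin : ∀ t ∈ Icc s (s + ρ ^ 2), ∃ z : ℂ, ‖z‖ = t ∧ ‖p.eval z‖ ≤ 1) {z : ℂ} (hz : ‖z‖ = s) :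
    ‖p.eval z‖ ≤ Real.exp (L * (4 / Real.pi * (Real.sqrt (2 * s) / ρ))) := by
  rcases eq_or_ne p 0 with rfl | hp
  · simpa using (Real.exp_pos _).le
  have hr : 0 < r := by nlinarith [sq_nonneg ρ]
  obtain ⟨F, hF, hFL, hFp⟩ := p.exists_radial_comparison hr hCL hp hC
  have hzr : z ∈ ball (0 : ℂ) r := by
    rw [mem_ball_zero_iff, hz]
    nlinarith [sq_nonneg ρ]
  refine (hFp z hzr).2.trans ?_
  rw [hz]
  refine norm_le_exp_of_norm_le_one_on_slit hs hρ hsr hsρ hL hF hFL fun t ht => ?_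
  obtain ⟨w, hw, hw1⟩ := hmin t ht
  have := (hFp w (by rw [mem_ball_zero_iff, hw]; exact ht.2.trans_lt hsr)).1
  rw [hw] at this
  exact this.trans hw1

open Metric Set Polynomial in
theorem Differentiable.exists_polynomial_norm_sub_lt {f : ℂ → ℂ} (hf : Differentiable ℂ f)
    (R : ℝ) {ε : ℝ} (hε : 0 < ε) :
    ∃ p : ℂ[X], ∀ z ∈ closedBall (0 : ℂ) R, ‖p.eval z - f z‖ < ε := by
  have h := hf.hasFPowerSeriesOnBall 0 (R := 1) one_pos
  have hu := h.tendstoUniformlyOn' (r' := (R + 1).toNNReal) ENNReal.coe_lt_top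
  rw [Metric.tendstoUniformlyOn_iff] at hu
  obtain ⟨n, hn⟩ := (hu ε hε).exists
  refine ⟨∑ i ∈ Finset.range n, Polynomial.C ((cauchyPowerSeries f 0 1).coeff i) * X ^ i,
    fun z hz => ?_⟩
  have hz' : ‖z‖ ≤ R := mem_closedBall_zero_iff.1 hz
  have := hn z (by
    rw [mem_ball_zero_iff, Real.coe_toNNReal _ (by linarith [norm_nonneg z])]
    linarith)
  rw [dist_comm, dist_eq_norm] at this
  have e : (∑ i ∈ Finset.range n, Polynomial.C ((cauchyPowerSeries f 0 1).coeff i) * X ^ i).eval z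
      = (cauchyPowerSeries f 0 1).partialSum n (z - 0) := by
    rw [eval_finsetSum, FormalMultilinearSeries.partialSum, sub_zero]
    refine Finset.sum_congr rfl fun i _ => ?_
    rw [FormalMultilinearSeries.apply_eq_pow_smul_coeff, smul_eq_mul, eval_mul, eval_C, eval_pow,
      eval_X, mul_comm]
  rwa [e]

open Metric Set in
/-- Beurling's estimate for entire functions: if `f` is at most `1` in modulus somewhere on each
circle of radius in `[s, s + ρ²]`, then it is not large on the circle of radius `s`. -/
theorem Differentiable.norm_le_exp_of_circles {f : ℂ → ℂ} (hf : Differentiable ℂ f)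
    {r s ρ C L : ℝ} (hs : 0 < s) (hρ : 0 < ρ)
    (hsr : s + ρ ^ 2 < r) (hsρ : 2 * s ≤ ρ ^ 2) (hL : 0 ≤ L) (hC1 : 1 ≤ C) (hCL : C < Real.exp L)
    (hC : ∀ z : ℂ, ‖z‖ = r → ‖f z‖ ≤ C)
    (hmin : ∀ t ∈ Icc s (s + ρ ^ 2), ∃ z : ℂ, ‖z‖ = t ∧ ‖f z‖ ≤ 1) {z : ℂ} (hz : ‖z‖ = s) :
    ‖f z‖ ≤ Real.exp (L * (4 / Real.pi * (Real.sqrt (2 * s) / ρ))) := by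
  set E := Real.exp (L * (4 / Real.pi * (Real.sqrt (2 * s) / ρ)))
  have hE : 0 < E := Real.exp_pos _
  have key : ∀ δ : ℝ, 0 < δ → ‖f z‖ ≤ (1 + δ) * E + δ := by
    intro δ hδ
    obtain ⟨p, hp⟩ := hf.exists_polynomial_norm_sub_lt r hδ
    have hp' : ∀ w : ℂ, ‖w‖ ≤ r → ‖p.eval w‖ ≤ ‖f w‖ + δ ∧ ‖f w‖ ≤ ‖p.eval w‖ + δ := by
      intro w hw
      have h1 := (hp w (mem_closedBall_zero_iff.2 hw)).le
      have h2 := norm_le_norm_add_norm_sub' (p.eval w) (f w)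
      have h3 := norm_le_norm_add_norm_sub (p.eval w) (f w)
      constructor <;> linarith
    -- Dividing by `1 + δ` restores the bounds `1` and `C` (as `1 ≤ C`) after an error `δ`.
    have hev : ∀ w : ℂ, ‖(Polynomial.C ((1 + δ : ℝ) : ℂ)⁻¹ * p).eval w‖
        = ‖p.eval w‖ / (1 + δ) := by
      intro w
      rw [Polynomial.eval_mul, Polynomial.eval_C, norm_mul, norm_inv, Complex.norm_real,
        Real.norm_of_nonneg (by positivity), inv_mul_eq_div]
    have := (Polynomial.C ((1 + δ : ℝ) : ℂ)⁻¹ * p).norm_le_exp_of_circles hs hρ hsr hsρ hL hCL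
      (fun w hw => by
        rw [hev, div_le_iff₀ (by positivity)]
        nlinarith [(hp' w hw.le).1, hC w hw])
      (fun t ht => by
        obtain ⟨w, hw, hw1⟩ := hmin t ht
        refine ⟨w, hw, ?_⟩
        rw [hev, div_le_one (by positivity)]
        linarith [(hp' w (by rw [hw]; exact ht.2.trans hsr.le)).1]) hz
    rw [hev, div_le_iff₀ (by positivity)] at this
    have h2 := (hp' z (by rw [hz]; nlinarith [sq_nonneg ρ])).2
    linarith
  refine le_of_forall_pos_le_add fun ε hε => ?_
  refine (key (ε / (E + 1)) (by positivity)).trans (le_of_eq ?_)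
  field_simp
  ring

/-! ### Maximum and minimum modulus; conclusion -/

open Metric Set in
theorem Differentiable.norm_le_maxModulus {f : ℂ → ℂ} (hf : Differentiable ℂ f) {r : ℝ}
    {z : ℂ} (hr : 0 < r) (hz : ‖z‖ ≤ r) : ‖f z‖ ≤ maxModulus f r := by
  have hb : BddAbove ((fun z : ℂ => ‖f z‖) '' sphere (0 : ℂ) r) :=
    ((isCompact_sphere _ _).image (hf.continuous.norm)).bddAbove
  refine Complex.norm_le_of_forall_mem_frontier_norm_le (isBounded_ball (x := (0 : ℂ)) (r := r))
    hf.diffContOnCl (fun w hw => ?_) (by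
      rw [closure_ball _ hr.ne']
      exact mem_closedBall_zero_iff.2 hz)
  rw [frontier_ball _ hr.ne'] at hw
  exact le_csSup hb (mem_image_of_mem _ hw)

open Metric Set in
theorem Differentiable.maxModulus_mono {f : ℂ → ℂ} (hf : Differentiable ℂ f) {r R : ℝ}
    (hr : 0 < r) (hrR : r ≤ R) : maxModulus f r ≤ maxModulus f R := by
  refine csSup_le ((NormedSpace.sphere_nonempty.2 hr.le).image _) ?_
  rintro _ ⟨w, hw, rfl⟩
  exact hf.norm_le_maxModulus (hr.trans_le hrR) ((mem_sphere_zero_iff_norm.1 hw).le.trans hrR)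

open Metric Set in
theorem Continuous.exists_norm_eq_minModulus {f : ℂ → ℂ} (hf : Continuous f) {t : ℝ} (ht : 0 ≤ t) :
    ∃ z : ℂ, ‖z‖ = t ∧ ‖f z‖ = minModulus f t := by
  obtain ⟨z, hz, h⟩ := ((isCompact_sphere (0 : ℂ) t).image hf.norm).sInf_mem
    ((NormedSpace.sphere_nonempty.2 ht).image _)
  exact ⟨z, mem_sphere_zero_iff_norm.1 hz, h⟩

theorem IsTranscendentalEntire.exists_lt_norm {f : ℂ → ℂ} (hf : IsTranscendentalEntire f) (B : ℝ) :
    ∃ z, B < ‖f z‖ := by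
  by_contra! h
  refine hf.2 ⟨Polynomial.C (f 0), fun z => ?_⟩
  rw [Polynomial.eval_C]
  refine hf.1.apply_eq_apply_of_bounded ?_ z 0
  rw [isBounded_iff_forall_norm_le]
  exact ⟨B, by rintro _ ⟨z, rfl⟩; exact h z⟩

theorem theorem4 (f : ℂ → ℂ) (hf : IsTranscendentalEntire f) :
    ∃ rf : ℝ, 0 < rf ∧ ∀ (r α : ℝ), 0 < r → 0 < α → α < 1 / 2 →
      Real.log (maxModulus f r) ≤ r ^ α → rf ≤ r ^ (1 - 2 * α) →
      ∃ t ∈ Set.Ioo (r ^ (1 - 2 * α)) r,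
        0 < minModulus f t ∧
        Real.log (minModulus f t) > Real.log (maxModulus f (r ^ (1 - 2 * α))) - 2 := by
  have hd := hf.1
  obtain ⟨z₀, hz₀⟩ := hf.exists_lt_norm (Real.exp 10)
  -- This forces `10 < log M(s) ≤ y`, hence `100 * s ≤ r`.
  refine ⟨max ‖z₀‖ 2, lt_max_of_lt_right two_pos, ?_⟩
  intro r α hr hα hα2 hlog hrf
  set s := r ^ (1 - 2 * α) with hs
  set y := r ^ α with hy
  have hs2 : 2 ≤ s := (le_max_right _ _).trans hrf
  have hs0 : 0 < s := by linarith
  have hr1 : 1 < r := by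
    by_contra! h
    have := Real.rpow_le_one hr.le h (by linarith : 0 ≤ 1 - 2 * α)
    linarith
  have hy0 : 0 < y := Real.rpow_pos_of_pos hr _
  have hsy : s * y ^ 2 = r := by
    rw [hs, hy, ← Real.rpow_natCast, ← Real.rpow_mul hr.le, ← Real.rpow_add hr]
    norm_num
    rw [show 1 - 2 * α + α * 2 = 1 by ring, Real.rpow_one]
  have hsr : s < r := by
    rw [hs]
    exact Real.rpow_lt_self_of_one_lt hr1 (by linarith)
  have hMs : Real.exp 10 < maxModulus f s :=
    hz₀.trans_le (hd.norm_le_maxModulus hs0 ((le_max_left _ _).trans hrf))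
  have hMs0 : 0 < maxModulus f s := (Real.exp_pos _).trans hMs
  have hMsr := hd.maxModulus_mono hs0 hsr.le
  have hMr0 : 0 < maxModulus f r := hMs0.trans_le hMsr
  set B := Real.log (maxModulus f s) with hB
  have hB10 : 10 < B := (Real.lt_log_iff_exp_lt hMs0).2 hMs
  have hBr : B ≤ Real.log (maxModulus f r) := Real.log_le_log hMs0 hMsr
  have hy10 : 10 < y := by linarith
  have hr100 : 100 * s ≤ r := by
    have : 100 ≤ y ^ 2 := by nlinarith
    rw [← hsy]
    nlinarith
  by_contra! hcon
  set E := Real.exp (B - 2) with hE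
  have hE0 : 0 < E := Real.exp_pos _
  have hnorm : ∀ w, ‖f w / (E : ℂ)‖ = ‖f w‖ / E := by
    intro w
    rw [norm_div, Complex.norm_real, Real.norm_of_nonneg hE0.le]
  have hsq : Real.sqrt (19 / 20 * r) ^ 2 = 19 / 20 * r := Real.sq_sqrt (by positivity)
  -- With inner radius `21 / 20 * s` and `ρ ^ 2 = 19 / 20 * r`, the closed range of radii lies
  -- inside the open interval `(s, r)`.
  have hmain : ∀ z : ℂ, ‖z‖ = 21 / 20 * s → ‖f z / (E : ℂ)‖ ≤
      Real.exp (y * (4 / Real.pi * (Real.sqrt (2 * (21 / 20 * s)) / Real.sqrt (19 / 20 * r)))) := by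
    intro z hz
    refine (hd.div_const (E : ℂ)).norm_le_exp_of_circles (r := r) (C := maxModulus f r / E)
      (by positivity) (by positivity) (by rw [hsq]; linarith) (by rw [hsq]; linarith) hy0.le
      ?_ ?_ ?_ ?_ hz
    · rw [one_le_div hE0, hE, ← Real.le_log_iff_exp_le hMr0]
      linarith
    · rw [div_lt_iff₀ hE0, hE, ← Real.exp_add, ← Real.log_lt_iff_lt_exp hMr0]
      linarith
    · intro w hw
      rw [hnorm]
      gcongr
      exact hd.norm_le_maxModulus hr hw.le
    · intro t ht
      rw [hsq] at ht
      obtain ⟨w, hw, hwm⟩ := hd.continuous.exists_norm_eq_minModulus (t := t) (by linarith [ht.1])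
      refine ⟨w, hw, ?_⟩
      rw [hnorm, div_le_one hE0, hwm]
      rcases le_or_gt (minModulus f t) 0 with h0 | h0
      · exact h0.trans hE0.le
      · rw [hE, ← Real.log_le_iff_le_exp h0]
        exact hcon t ⟨by linarith [ht.1], by linarith [ht.2]⟩ h0
  have hexp : y * (4 / Real.pi * (Real.sqrt (2 * (21 / 20 * s)) / Real.sqrt (19 / 20 * r)))
      < 2 := by
    have e : Real.sqrt (2 * (21 / 20 * s)) / Real.sqrt (19 / 20 * r)
        = Real.sqrt (42 / 19) / y := by
      rw [← Real.sqrt_div (by positivity), ← hsy]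
      have : 2 * (21 / 20 * s) / (19 / 20 * (s * y ^ 2)) = 42 / 19 / y ^ 2 := by
        field_simp
        norm_num
      rw [this, Real.sqrt_div (by norm_num), Real.sqrt_sq hy0.le]
    rw [e]
    have e2 : y * (4 / Real.pi * (Real.sqrt (42 / 19) / y))
        = 4 * Real.sqrt (42 / 19) / Real.pi := by field_simp
    rw [e2, div_lt_iff₀ Real.pi_pos]
    have : Real.sqrt (42 / 19) < 3 / 2 := by
      rw [Real.sqrt_lt' (by norm_num)]
      norm_num
    linarith [Real.pi_gt_three]
  have hsup : maxModulus f (21 / 20 * s) < maxModulus f s := by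
    obtain ⟨z, hz, h⟩ := ((isCompact_sphere (0 : ℂ) (21 / 20 * s)).image hd.continuous.norm).sSup_mem
      ((NormedSpace.sphere_nonempty.2 (by positivity)).image _)
    change ‖f z‖ = maxModulus f (21 / 20 * s) at h
    rw [← h]
    have h1 := hmain z (mem_sphere_zero_iff_norm.1 hz)
    rw [hnorm, div_le_iff₀ hE0, hE, ← Real.exp_add] at h1
    refine h1.trans_lt ?_
    rw [← Real.lt_log_iff_exp_lt hMs0]
    linarith
  exact hsup.not_ge (hd.maxModulus_mono hs0 (by linarith))
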